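/- For a family of graphs $\mathcal F$ and a graph $H$, write $G\to(\mathcal F,H)$ if every colouring of the edges of the graph $G$ with two colours, red and blue, yields a red copy of some graph from $\mathcal F$ or a blue copy of $H$ (copies are not necessarily induced subgraphs), and let $\hat R(\mathcal F,H)=\min\{|E(G)| : G \text{ a finite graph with } G\to(\mathcal F,H)\}$. Let $\mathcal C_{\le n}$ be the family of cycles of length at most $n$ (all cycles have length at least $3$), let $P_n$ be the path on $n$ vertices, and let $\mathcal G_{2n,31}$ be a uniformly random simple $31$-regular graph on the vertex set $\{1,\dots,2n\}$. Then $$\lim_{n\to\infty}\Pr\big(\mathcal G_{2n,31}\to(\mathcal C_{\le n},P_n)\big)=1 ,$$ and consequently $\hat R(\mathcal C_{\le n},P_n)\le 31n$ for all sufficiently large $n$. -/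

import Mathlib

open Filter Topology MeasureTheory ProbabilityTheory

namespace SizeRamsey

/-- The two colours used to colour edges. -/
inductive Colour
  | red
  | blue

/-- A finite graph on some vertex set `Fin m`; every finite graph is isomorphic to one of these. -/
abbrev FinGraph : Type := Σ m : ℕ, SimpleGraph (Fin m)

/-- `G → (𝓕, H)`: every colouring of the edges of `G` with two colours, red and blue, yields a red
copy of some graph from the family `𝓕` or a blue copy of `H`. Copies are subgraphs that need not
be induced. -/
def Arrows {V W : Type*} (G : SimpleGraph V) (𝓕 : Set FinGraph) (H : SimpleGraph W) : Prop :=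
  ∀ c : G.EdgeLabeling Colour,
    (∃ F ∈ 𝓕, F.2.IsContained (c.labelGraph Colour.red)) ∨
      H.IsContained (c.labelGraph Colour.blue)

/-- The size-Ramsey number `R̂(𝓕, H) = min {|E(G)| : G → (𝓕, H)}`, where `G` ranges over finite
graphs. It takes values in `ℕ∞`, and is `⊤` when there is no finite `G` with `G → (𝓕, H)`. -/
noncomputable def sizeRamsey {W : Type*} (𝓕 : Set FinGraph) (H : SimpleGraph W) : ℕ∞ :=
  sInf {m : ℕ∞ | ∃ (N : ℕ) (G : SimpleGraph (Fin N)), Arrows G 𝓕 H ∧ m = G.edgeSet.encard}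

/-- The family of cycles of length at most `n`; a cycle in a simple graph has length at least `3`. -/
def cyclesUpTo (n : ℕ) : Set FinGraph :=
  {F | ∃ k : ℕ, 3 ≤ k ∧ k ≤ n ∧ F = ⟨k, SimpleGraph.cycleGraph k⟩}

open Classical in
/-- The random `d`-regular graph: the uniform distribution on all (simple, labelled) `d`-regular
graphs with vertex set `Fin N`. It is a probability measure as soon as such a graph exists. -/
noncomputable def randomRegular (N d : ℕ) : Measure (SimpleGraph (Fin N)) :=
  uniformOn {G : SimpleGraph (Fin N) | G.IsRegularOfDegree d}

end SizeRamsey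

/-! A graph on $2n$ vertices that fails to arrow contains a sparse pair of sets. Since the blue
graph has no $P_n$, depth first search finds disjoint sets of sizes $\lfloor n/2\rfloor$ and $\lceil
n/2\rceil$ with no blue edge between them. All edges of $G$ between them are red, and $n$ red edges
on these $n$ vertices would contain a cycle of length at most $n$; so there are fewer than $n$
(`exists_sparse_of_not_arrows`).

A first moment count in the configuration model excludes such pairs. A word assigns a vertex to each
of $2dn$ half-edges, using every vertex $d$ times. Each $d$-regular graph arises from exactly
$(dn)!\,2^{dn}$ words, and words of simple graphs form at least an inverse polynomial share of all
words (`card_words_le`). This loss is harmless against an exponentially small failure bound.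

For a fixed pair only the class of each letter matters (`card_filter_comp_mul_card`), which leaves
uniform words in three letters. There are at least $8^{dn}/\mathrm{poly}(n)$ of them, an exponential
moment bounds the sparse ones (`card_sparse_mul_le`), and there are at most $8^n$ pairs. With
$Q=1+4\xi+(2+2\theta)\xi^2$ the failure ratio is at most $\mathrm{poly}(n)\,(8(Q/8\xi)^d/\theta)^n$,
whose base can be made less than 1 for $d=31$. Once failure has probability below 1, some 31-regular
graph arrows, and it has $31n$ edges. -/

namespace SizeRamsey

/-! ### Failure to arrow forces a sparse pair of vertex sets. -/

section Deterministic

variable {V : Type*}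

theorem card_edgeFinset_lt_of_isAcyclic [Fintype V] [Nonempty V] {G : SimpleGraph V}
    [Fintype G.edgeSet] (hG : G.IsAcyclic) : G.edgeFinset.card < Fintype.card V := by
  classical
  obtain ⟨H, hGH, hH⟩ := SimpleGraph.exists_maximal_isAcyclic_of_le_isAcyclic le_top hG
  have hT : H.IsTree :=
    (SimpleGraph.connected_top.maximal_le_isAcyclic_iff_isTree le_top).mp hH
  have h1 := hT.card_edgeFinset
  have h2 : G.edgeFinset.card ≤ H.edgeFinset.card :=
    Finset.card_le_card (SimpleGraph.edgeFinset_mono hGH)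
  omega

/-- A graph with at least as many edges as vertices on the nonempty set `S` contains a cycle of
length at most `|S|`. -/
theorem exists_cycleGraph_isContained {G : SimpleGraph V} {S : Finset V}
    (hS : S.Nonempty) {E : Finset (Sym2 V)} (hEG : ∀ e ∈ E, e ∈ G.edgeSet)
    (hES : ∀ e ∈ E, ∀ v ∈ e, v ∈ S) (hcard : S.card ≤ E.card) :
    ∃ k, 3 ≤ k ∧ k ≤ S.card ∧ (SimpleGraph.cycleGraph k).IsContained G := by
  classical
  let H : SimpleGraph S := G.comap Subtype.val
  have hHG : H.IsContained G := ⟨⟨⟨Subtype.val, fun h => h⟩, Subtype.val_injective⟩⟩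
  have hcyc : ¬ H.IsAcyclic := by
    intro hac
    have : Nonempty S := hS.to_subtype
    have h1 := card_edgeFinset_lt_of_isAcyclic hac
    rw [Fintype.card_coe] at h1
    have h2 : E ⊆ H.edgeFinset.image (Sym2.map Subtype.val) := by
      intro e he
      induction e using Sym2.ind with
      | _ x y =>
        have hx := hES _ he x (by simp)
        have hy := hES _ he y (by simp)
        refine Finset.mem_image.mpr ⟨s(⟨x, hx⟩, ⟨y, hy⟩), ?_, by simp⟩
        rw [SimpleGraph.mem_edgeFinset]
        exact hEG _ he
    have h3 := (Finset.card_le_card h2).trans Finset.card_image_le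
    omega
  rw [SimpleGraph.isAcyclic_iff_free_cycleGraph] at hcyc
  push Not at hcyc
  obtain ⟨k, hk, hfree⟩ := hcyc
  have hcont : (SimpleGraph.cycleGraph k).IsContained H := hfree
  refine ⟨k, hk, ?_, hcont.trans hHG⟩
  obtain ⟨f⟩ := hcont
  simpa using Fintype.card_le_of_injective f.toHom f.injective'

theorem pathGraph_isContained_of_isChain {G : SimpleGraph V} {l : List V} {n : ℕ}
    (hl : l.IsChain G.Adj) (hnd : l.Nodup) (hn : n ≤ l.length) :
    (SimpleGraph.pathGraph n).IsContained G := by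
  rw [List.isChain_iff_getElem] at hl
  refine ⟨⟨⟨fun i => l[i.1]'(i.2.trans_le hn), ?_⟩, ?_⟩⟩
  · intro i j hij
    rw [SimpleGraph.pathGraph_adj] at hij
    rcases hij with h | h
    · have := hl i.1 (by omega)
      simpa [h] using this
    · have := hl j.1 (by omega)
      simpa [h] using this.symm
  · intro i j hij
    have := (List.Nodup.getElem_inj_iff hnd).mp hij
    exact Fin.ext this

/-- The depth first search argument: a state of the search for every value of `|T| - |S|`. -/
theorem exists_search_state [Fintype V] [DecidableEq V] (G : SimpleGraph V) (j : ℕ)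
    (hj : j ≤ Fintype.card V) :
    ∃ (S T : Finset V) (l : List V), l.Nodup ∧ l.IsChain G.Adj ∧ Disjoint S T ∧
      (∀ v ∈ l, v ∉ S ∧ v ∉ T) ∧ (∀ s ∈ S, ∀ t ∈ T, ¬ G.Adj s t) ∧
      S.card + T.card + l.length = Fintype.card V ∧
      T.card + j = S.card + Fintype.card V := by
  induction j with
  | zero =>
    exact ⟨∅, Finset.univ, [], by simp, by simp, by simp, by simp, by simp, by simp, by simp⟩
  | succ j ih =>
    obtain ⟨S, T, l, hnd, hch, hdis, hl, hST, hc1, hc2⟩ := ih (by omega)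
    have hTpos : T.Nonempty := by
      rw [← Finset.card_pos]; omega
    -- Either a vertex of `T` extends the path at its head, or the head has no neighbour in `T` and
    -- retires to `S`. Both moves lower $|T|-|S|$ by exactly one, so every intermediate value is
    -- attained.
    by_cases hext : ∃ t ∈ T, (t :: l).IsChain G.Adj
    · obtain ⟨t, ht, htl⟩ := hext
      have hT := Finset.card_erase_add_one ht
      refine ⟨S, T.erase t, t :: l, ?_, htl, ?_, ?_, ?_, ?_, ?_⟩
      · exact List.nodup_cons.mpr ⟨fun h => (hl t h).2 ht, hnd⟩
      · exact hdis.mono_right (Finset.erase_subset _ _)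
      · intro v hv
        rcases List.mem_cons.mp hv with rfl | hv
        · exact ⟨fun h => Finset.disjoint_left.mp hdis h ht, by simp⟩
        · exact ⟨(hl v hv).1, fun h => (hl v hv).2 (Finset.mem_of_mem_erase h)⟩
      · intro s hs t' ht'
        exact hST s hs t' (Finset.mem_of_mem_erase ht')
      · rw [List.length_cons]; omega
      · omega
    · match l, hnd, hch, hl, hc1, hext with
      | [], _, _, _, _, hext =>
        obtain ⟨t, ht⟩ := hTpos
        exact absurd ⟨t, ht, by simp⟩ hext
      | v :: l, hnd, hch, hl, hc1, hext =>
        have hv := hl v (by simp)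
        refine ⟨insert v S, T, l, (List.nodup_cons.mp hnd).2, hch.tail, ?_, ?_, ?_, ?_, ?_⟩
        · exact Finset.disjoint_insert_left.mpr ⟨hv.2, hdis⟩
        · intro u hu
          have hu' := hl u (List.mem_cons_of_mem _ hu)
          refine ⟨fun h => ?_, hu'.2⟩
          rcases Finset.mem_insert.mp h with rfl | h
          · exact (List.nodup_cons.mp hnd).1 hu
          · exact hu'.1 h
        · intro s hs t ht hadj
          rcases Finset.mem_insert.mp hs with rfl | hs
          · exact hext ⟨t, ht, List.isChain_cons_cons.mpr ⟨hadj.symm, hch⟩⟩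
          · exact hST s hs t ht hadj
        · rw [Finset.card_insert_of_notMem hv.1]
          rw [List.length_cons] at hc1; omega
        · rw [Finset.card_insert_of_notMem hv.1]; omega

/-- Without a path on `n` vertices there is a large pair of sets with no edges in between. -/
theorem exists_disjoint_no_edges [Fintype V] [DecidableEq V] {G : SimpleGraph V} {n : ℕ}
    (hG : ¬ (SimpleGraph.pathGraph n).IsContained G) :
    ∃ S T : Finset V, Disjoint S T ∧ (∀ s ∈ S, ∀ t ∈ T, ¬ G.Adj s t) ∧ S.card = T.card ∧
      Fintype.card V < 2 * S.card + n := by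
  obtain ⟨S, T, l, hnd, hch, hdis, -, hST, hc1, hc2⟩ := exists_search_state G _ le_rfl
  have hlen : l.length < n := by
    by_contra h
    exact hG (pathGraph_isContained_of_isChain hch hnd (not_lt.mp h))
  exact ⟨S, T, hdis, hST, by omega, by omega⟩

/-- A graph on `2 n` vertices without the Ramsey property has a sparse pair of disjoint sets,
described here as the first two classes of a partition of the vertices. -/
theorem exists_sparse_of_not_arrows [Fintype V] [DecidableEq V] {G : SimpleGraph V} {n : ℕ}
    (hn : 0 < n) (hV : Fintype.card V = 2 * n)
    (hG : ¬ Arrows G (cyclesUpTo n) (SimpleGraph.pathGraph n)) :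
    ∃ τ : V → Fin 3, (Finset.univ.filter fun v => τ v = 0).card = n / 2 ∧
      (Finset.univ.filter fun v => τ v = 1).card = n - n / 2 ∧
      ∀ E : Finset (Sym2 V), (∀ e ∈ E, e ∈ G.edgeSet ∧ e.map τ = s(0, 1)) → E.card < n := by
  classical
  unfold Arrows at hG
  push Not at hG
  obtain ⟨c, hred, hblue⟩ := hG
  obtain ⟨S', T', hdis, hno, hcard, hlarge⟩ := exists_disjoint_no_edges (not_nonempty_iff.mpr hblue)
  obtain ⟨S, hSS, hS⟩ := Finset.exists_subset_card_eq (s := S') (n := n / 2) (by omega)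
  obtain ⟨T, hTT, hT⟩ := Finset.exists_subset_card_eq (s := T') (n := n - n / 2) (by omega)
  have hST : Disjoint S T := hdis.mono hSS hTT
  refine ⟨fun v => if v ∈ S then 0 else if v ∈ T then 1 else 2, ?_, ?_, ?_⟩
  · rw [← hS]; refine congrArg _ (Finset.ext fun v => ?_); simp; split_ifs <;> simp_all
  · rw [← hT]; refine congrArg _ (Finset.ext fun v => ?_)
    have := fun h : v ∈ S => Finset.disjoint_left.mp hST h
    simp; split_ifs <;> simp_all
  · intro E hE
    by_contra! hcE
    have hU : (S ∪ T).card = n := by rw [Finset.card_union_of_disjoint hST]; omega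
    have key : ∀ e ∈ E, e ∈ (c.labelGraph Colour.red).edgeSet ∧ ∀ v ∈ e, v ∈ S ∪ T := by
      intro e he
      obtain ⟨heG, hτ⟩ := hE e he
      induction e using Sym2.ind with
      | _ x y =>
        have hxy : (x ∈ S ∧ y ∈ T) ∨ (y ∈ S ∧ x ∈ T) := by
          rw [Sym2.map_mk, Sym2.eq_iff] at hτ
          split_ifs at hτ <;> simp_all
        have hnb : ¬ (c.labelGraph Colour.blue).Adj x y := by
          rcases hxy with ⟨hx, hy⟩ | ⟨hy, hx⟩
          · exact hno x (hSS hx) y (hTT hy)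
          · exact fun h => hno y (hSS hy) x (hTT hx) h.symm
        rw [SimpleGraph.EdgeLabeling.labelGraph_adj] at hnb
        refine ⟨?_, ?_⟩
        · rw [SimpleGraph.mem_edgeSet, SimpleGraph.EdgeLabeling.labelGraph_adj]
          refine ⟨heG, ?_⟩
          cases hc : c ⟨s(x, y), heG⟩ with
          | red => rfl
          | blue => exact absurd ⟨heG, hc⟩ hnb
        · intro v hv
          rcases Sym2.mem_iff.mp hv with rfl | rfl <;> rw [Finset.mem_union] <;> tauto
    obtain ⟨k, hk, hkn, hcont⟩ := exists_cycleGraph_isContained (S := S ∪ T)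
      (Finset.card_pos.mp (by omega)) (fun e he => (key e he).1) (fun e he => (key e he).2)
      (by omega)
    exact not_nonempty_iff.mpr (hred _ ⟨k, hk, by omega, rfl⟩) hcont

end Deterministic

/-! ### Uniform words with prescribed letter counts: coincidences of letters. -/

section Words

theorem card_filter_comp_perm {P A : Type*} [Fintype P] [DecidableEq A] (w : P → A) (σ : Equiv.Perm P) (a : A) :
    (Finset.univ.filter fun p => (w ∘ σ) p = a).card =
      (Finset.univ.filter fun p => w p = a).card := by
  refine Finset.card_bij (fun p _ => σ p) (by simp) (by simp) fun p hp => ⟨σ.symm p, ?_, by simp⟩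
  simpa using hp

theorem comp_swap_comp_swap {P A : Type*} [DecidableEq P] (w : P → A) (p q : P) :
    (w ∘ Equiv.swap p q) ∘ Equiv.swap p q = w := by
  funext r; simp

variable {P A : Type*} [Fintype P] [DecidableEq P] [Fintype A] [DecidableEq A]

/-- The words with positions `P` in which every letter `a` occurs exactly `c a` times. -/
def words (P : Type*) {A : Type*} [Fintype P] [DecidableEq P] [Fintype A] [DecidableEq A]
    (c : A → ℕ) : Finset (P → A) :=
  Finset.univ.filter fun w => ∀ a, (Finset.univ.filter fun p => w p = a).card = c a

theorem mem_words {c : A → ℕ} {w : P → A} :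
    w ∈ words P c ↔ ∀ a, (Finset.univ.filter fun p => w p = a).card = c a := by
  simp [words]

theorem comp_perm_mem_words {c : A → ℕ} {w : P → A} (hw : w ∈ words P c) (σ : Equiv.Perm P) :
    w ∘ σ ∈ words P c := by
  rw [mem_words] at *
  intro a
  rw [card_filter_comp_perm, hw a]

/-- In a family of words that is invariant under permuting the positions outside `F`, a position
outside `F` carries the letter at position `p ∈ F` with the expected frequency. -/
theorem card_filter_eq_mul_le {c : A → ℕ} {d : ℕ} (hc : ∀ a, c a ≤ d + 1) (X : Finset (P → A))
    (hX : X ⊆ words P c) (F : Finset P)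
    (hinv : ∀ w ∈ X, ∀ q q', q ∉ F → q' ∉ F → w ∘ Equiv.swap q q' ∈ X)
    {p q : P} (hp : p ∈ F) (hq : q ∉ F) :
    (X.filter fun w => w p = w q).card * (Fintype.card P - F.card) ≤ d * X.card := by
  -- Swapping two positions outside `F` preserves `X` and the letter at `p`, so the count does not
  -- depend on `q`. Summed over all $q'\notin F$, each word contributes at most `d`, the further
  -- occurrences of its letter `w p`.
  have h1 : ∀ q' ∈ Fᶜ, (X.filter fun w => w p = w q').card =
      (X.filter fun w => w p = w q).card := by
    intro q' hq'
    rw [Finset.mem_compl] at hq'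
    have hpq : p ≠ q := fun h => hq (h ▸ hp)
    have hpq' : p ≠ q' := fun h => hq' (h ▸ hp)
    refine Finset.card_nbij' (fun w => w ∘ Equiv.swap q q') (fun w => w ∘ Equiv.swap q q')
      ?_ ?_ (fun w _ => comp_swap_comp_swap w q q') (fun w _ => comp_swap_comp_swap w q q')
    · intro w hw
      simp only [Finset.coe_filter, Set.mem_ofPred_eq] at hw ⊢
      refine ⟨hinv w hw.1 _ _ hq hq', ?_⟩
      simpa [Equiv.swap_apply_of_ne_of_ne hpq hpq'] using hw.2
    · intro w hw
      simp only [Finset.coe_filter, Set.mem_ofPred_eq] at hw ⊢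
      refine ⟨hinv w hw.1 _ _ hq hq', ?_⟩
      simpa [Equiv.swap_apply_of_ne_of_ne hpq hpq'] using hw.2
  have h2 : ∑ q' ∈ Fᶜ, (X.filter fun w => w p = w q').card =
      (X.filter fun w => w p = w q).card * (Fintype.card P - F.card) := by
    rw [Finset.sum_congr rfl h1, Finset.sum_const, Finset.card_compl, smul_eq_mul, mul_comm]
  rw [← h2]
  simp_rw [Finset.card_filter]
  rw [Finset.sum_comm]
  calc ∑ w ∈ X, ∑ q' ∈ Fᶜ, (if w p = w q' then 1 else 0) ≤ ∑ w ∈ X, d := by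
        refine Finset.sum_le_sum fun w hw => ?_
        rw [← Finset.card_filter]
        have h3 := mem_words.mp (hX hw) (w p)
        have h4 : (Fᶜ.filter fun q' => w p = w q') ⊆
            (Finset.univ.filter fun p' => w p' = w p).erase p := by
          intro r hr
          simp only [Finset.mem_filter, Finset.mem_compl, Finset.mem_erase, Finset.mem_univ,
            true_and] at hr ⊢
          exact ⟨fun h => hr.1 (h ▸ hp), hr.2.symm⟩
        have h5 := Finset.card_le_card h4
        rw [Finset.card_erase_of_mem (by simp), h3] at h5
        have := hc (w p)
        omega
    _ = d * X.card := by rw [Finset.sum_const, smul_eq_mul, mul_comm]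

theorem card_filter_eq_mul_le_of_ne {c : A → ℕ} {d : ℕ} (hc : ∀ a, c a ≤ d + 1) {p q : P}
    (hpq : p ≠ q) :
    ((words P c).filter fun w => w p = w q).card * (Fintype.card P - 1) ≤
      d * (words P c).card := by
  have := card_filter_eq_mul_le hc (words P c) subset_rfl {p}
    (fun w hw q q' _ _ => comp_perm_mem_words hw _) (p := p) (q := q) (by simp)
    (by simpa using hpq.symm)
  simpa using this

/-- Condition on `w r = w s`: the restricted family is still symmetric in the positions outside
$\{p,r,s\}$, so the frequency bound applies twice. -/
theorem card_filter_two_eq_mul_le {c : A → ℕ} {d : ℕ} (hc : ∀ a, c a ≤ d + 1) {p q r s : P}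
    (hpq : p ≠ q) (hrs : r ≠ s) (hpr : p ≠ r) (hps : p ≠ s) (hqr : q ≠ r) (hqs : q ≠ s) :
    ((words P c).filter fun w => w p = w q ∧ w r = w s).card *
      ((Fintype.card P - 1) * (Fintype.card P - 3)) ≤ d ^ 2 * (words P c).card := by
  have h1 := card_filter_eq_mul_le (P := P) hc ((words P c).filter fun w => w r = w s)
    (Finset.filter_subset _ _) {p, r, s} (fun w hw q q' hq hq' => by
      simp only [Finset.mem_insert, Finset.mem_singleton, not_or] at hq hq'
      rw [Finset.mem_filter] at hw ⊢
      refine ⟨comp_perm_mem_words hw.1 _, ?_⟩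
      simpa [Equiv.swap_apply_of_ne_of_ne (Ne.symm hq.2.1) (Ne.symm hq'.2.1),
        Equiv.swap_apply_of_ne_of_ne (Ne.symm hq.2.2) (Ne.symm hq'.2.2)] using hw.2)
    (p := p) (q := q) (by simp) (by simp [hpq.symm, hqr, hqs])
  have hcard : ({p, r, s} : Finset P).card = 3 := Finset.card_eq_three.mpr
    ⟨p, r, s, hpr, hps, hrs, rfl⟩
  have h2 := card_filter_eq_mul_le_of_ne (c := c) hc hrs
  rw [hcard, Finset.filter_filter] at h1
  have h3 : ((words P c).filter fun w => w r = w s ∧ w p = w q) =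
      (words P c).filter fun w => w p = w q ∧ w r = w s := by
    simp only [and_comm]
  rw [h3] at h1
  calc _ = (((words P c).filter fun w => w p = w q ∧ w r = w s).card *
        (Fintype.card P - 3)) * (Fintype.card P - 1) := by ring
    _ ≤ (d * ((words P c).filter fun w => w r = w s).card) * (Fintype.card P - 1) :=
        Nat.mul_le_mul_right _ h1
    _ = d * (((words P c).filter fun w => w r = w s).card * (Fintype.card P - 1)) := by ring
    _ ≤ d * (d * (words P c).card) := Nat.mul_le_mul_left _ h2
    _ = _ := by ring

end Words

/-! ### The expected number of loops and multiple edges. -/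

section Pairs

variable {ι A : Type*} [Fintype ι] [DecidableEq ι] [Fintype A] [DecidableEq A]

/-- The `i`-th (possibly degenerate) edge of a word with positions `ι × Bool`. -/
def wordEdge {ι A : Type*} (w : ι × Bool → A) (i : ι) : Sym2 A := s(w (i, false), w (i, true))

/-- The indices of the loops and of the multiple edges of a word. -/
def defects (w : ι × Bool → A) : Finset ι :=
  Finset.univ.filter fun i =>
    w (i, false) = w (i, true) ∨ ∃ j, j ≠ i ∧ wordEdge w j = wordEdge w i

/-- With $m$ edges, a given edge is a loop with probability at most $d/m$, and agrees with another
given edge with probability at most $d^2/m^2$; add over edges and pairs. -/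
theorem sum_card_defects_le {c : A → ℕ} {d : ℕ} (hc : ∀ a, c a ≤ d + 1)
    (hm : 4 ≤ Fintype.card ι) :
    ∑ w ∈ words (ι × Bool) c, (defects w).card ≤ (d + d ^ 2) * (words (ι × Bool) c).card := by
  set Ω := words (ι × Bool) c with hΩ
  set m := Fintype.card ι with hmdef
  have hP : Fintype.card (ι × Bool) = 2 * m := by simp [hmdef, mul_comm]
  have hloop : ∀ i : ι, m * (Ω.filter fun w => w (i, false) = w (i, true)).card ≤ d * Ω.card := by
    intro i
    have := card_filter_eq_mul_le_of_ne (P := ι × Bool) hc (p := (i, false)) (q := (i, true))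
      (by simp)
    rw [hP, mul_comm] at this
    exact (Nat.mul_le_mul_right _ (by omega)).trans this
  have hdouble : ∀ i j : ι, m * (m * ((Ω.filter fun w => j ≠ i ∧ wordEdge w j = wordEdge w i).card))
      ≤ d ^ 2 * Ω.card := by
    intro i j
    by_cases hij : j = i
    · simp [hij]
    · have hA := card_filter_two_eq_mul_le (P := ι × Bool) hc (p := (j, false)) (q := (i, false))
        (r := (j, true)) (s := (i, true)) (by simpa) (by simpa) (by simp) (by simp) (by simp)
        (by simp)
      have hB := card_filter_two_eq_mul_le (P := ι × Bool) hc (p := (j, false)) (q := (i, true))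
        (r := (j, true)) (s := (i, false)) (by simp) (by simp) (by simp) (by simpa)
        (by simpa using fun h => hij h.symm) (by simp)
      rw [hP] at hA hB
      have hsub : (Ω.filter fun w => j ≠ i ∧ wordEdge w j = wordEdge w i) ⊆
          (Ω.filter fun w => w (j, false) = w (i, false) ∧ w (j, true) = w (i, true)) ∪
          (Ω.filter fun w => w (j, false) = w (i, true) ∧ w (j, true) = w (i, false)) := by
        intro w hw
        rw [Finset.mem_filter, wordEdge, wordEdge, Sym2.eq_iff] at hw
        rw [Finset.mem_union, Finset.mem_filter, Finset.mem_filter]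
        tauto
      have hcard := (Finset.card_le_card hsub).trans (Finset.card_union_le _ _)
      -- The factor 2 pays for the two orientations in which edges can agree; this is where $m\ge 4$
      -- is needed.
      have hmm : 2 * (m * m) ≤ (2 * m - 1) * (2 * m - 3) := by
        obtain ⟨k, hk⟩ := Nat.exists_eq_add_of_le hm
        have e1 : 2 * m - 1 = 2 * k + 7 := by omega
        have e2 : 2 * m - 3 = 2 * k + 5 := by omega
        rw [e1, e2, hk]; nlinarith
      nlinarith [Nat.mul_le_mul_right (Ω.filter fun w => w (j, false) = w (i, false) ∧
          w (j, true) = w (i, true)).card hmm, Nat.mul_le_mul_right (Ω.filter fun w =>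
          w (j, false) = w (i, true) ∧ w (j, true) = w (i, false)).card hmm,
        Nat.mul_le_mul_left (m * m) hcard]
  have hsum : ∑ w ∈ Ω, (defects w).card ≤
      ∑ i : ι, ((Ω.filter fun w => w (i, false) = w (i, true)).card +
        ∑ j : ι, (Ω.filter fun w => j ≠ i ∧ wordEdge w j = wordEdge w i).card) := by
    simp_rw [defects, Finset.card_filter _ Finset.univ]
    rw [Finset.sum_comm]
    refine Finset.sum_le_sum fun i _ => ?_
    rw [← Finset.card_filter]
    have : (Ω.filter fun w => w (i, false) = w (i, true) ∨
        ∃ j, j ≠ i ∧ wordEdge w j = wordEdge w i) ⊆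
        (Ω.filter fun w => w (i, false) = w (i, true)) ∪
        Finset.univ.biUnion fun j => Ω.filter fun w => j ≠ i ∧ wordEdge w j = wordEdge w i := by
      intro w hw
      simp only [Finset.mem_filter, Finset.mem_union, Finset.mem_biUnion, Finset.mem_univ,
        true_and] at hw ⊢
      rcases hw with ⟨h1, h2 | ⟨j, h3⟩⟩
      · exact Or.inl ⟨h1, h2⟩
      · exact Or.inr ⟨j, h1, h3⟩
    refine (Finset.card_le_card this).trans ((Finset.card_union_le _ _).trans ?_)
    exact Nat.add_le_add_left Finset.card_biUnion_le _
  refine hsum.trans ?_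
  have hm0 : 0 < m := by omega
  have hrow : ∀ i : ι, m * ((Ω.filter fun w => w (i, false) = w (i, true)).card +
        ∑ j : ι, (Ω.filter fun w => j ≠ i ∧ wordEdge w j = wordEdge w i).card) ≤
      (d + d ^ 2) * Ω.card := by
    intro i
    have : m * ∑ j : ι, (Ω.filter fun w => j ≠ i ∧ wordEdge w j = wordEdge w i).card ≤
        d ^ 2 * Ω.card := by
      refine Nat.le_of_mul_le_mul_left ?_ hm0
      rw [Finset.mul_sum, Finset.mul_sum]
      calc _ ≤ ∑ j : ι, d ^ 2 * Ω.card := Finset.sum_le_sum fun j _ => hdouble i j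
        _ = _ := by rw [Finset.sum_const, Finset.card_univ, smul_eq_mul]
    rw [mul_add, add_mul]
    exact add_le_add (hloop i) this
  refine Nat.le_of_mul_le_mul_left ?_ hm0
  rw [Finset.mul_sum]
  calc _ ≤ ∑ i : ι, (d + d ^ 2) * Ω.card := Finset.sum_le_sum fun i _ => hrow i
    _ = _ := by rw [Finset.sum_const, Finset.card_univ, smul_eq_mul]

end Pairs

/-! ### Removing defects by switchings. -/

section Switching

variable {ι A : Type*} [Fintype ι] [DecidableEq ι] [Fintype A] [DecidableEq A]

theorem mem_defects {ι A : Type*} [Fintype ι] [DecidableEq ι] [DecidableEq A] {w : ι × Bool → A} {i : ι} :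
    i ∈ defects w ↔ w (i, false) = w (i, true) ∨ ∃ j, j ≠ i ∧ wordEdge w j = wordEdge w i := by
  simp [defects]

/-- The letters joined to `a` by an edge of the word, together with `a`. -/
def closedNeighbours {ι A : Type*} [Fintype ι] [DecidableEq A] (w : ι × Bool → A) (a : A) : Finset A :=
  insert a ((Finset.univ.filter fun p => w p = a).image fun p => w (p.1, !p.2))

theorem mem_closedNeighbours_of_wordEdge_eq {ι A : Type*} [Fintype ι] [DecidableEq A]
    {w : ι × Bool → A} {a b : A} {k : ι}
    (h : wordEdge w k = s(a, b)) : b ∈ closedNeighbours w a := by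
  rw [wordEdge, Sym2.eq_iff] at h
  refine Finset.mem_insert_of_mem (Finset.mem_image.mpr ?_)
  rcases h with h | h
  · exact ⟨(k, false), by simpa using h.1, by simpa using h.2⟩
  · exact ⟨(k, true), by simpa using h.2, by simpa using h.1⟩

theorem card_filter_mem_le {c : A → ℕ} {d : ℕ} (hc : ∀ a, c a ≤ d) {w : ι × Bool → A}
    (hw : w ∈ words (ι × Bool) c) (Z : Finset A) (β : Bool) :
    (Finset.univ.filter fun j => w (j, β) ∈ Z).card ≤ d * Z.card := by
  have h1 : (Finset.univ.filter fun j => w (j, β) ∈ Z) ⊆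
      Z.biUnion fun z => (Finset.univ.filter fun p => w p = z).image Prod.fst := by
    intro j hj
    simp only [Finset.mem_filter, Finset.mem_univ, true_and] at hj
    refine Finset.mem_biUnion.mpr ⟨_, hj, Finset.mem_image.mpr ⟨(j, β), by simp, rfl⟩⟩
  refine (Finset.card_le_card h1).trans (Finset.card_biUnion_le.trans ?_)
  rw [mul_comm, ← smul_eq_mul]
  refine Finset.sum_le_card_nsmul _ _ _ fun z _ => ?_
  refine Finset.card_image_le.trans ?_
  rw [mem_words.mp hw]
  exact hc z

theorem card_closedNeighbours_le {c : A → ℕ} {d : ℕ} (hc : ∀ a, c a ≤ d) {w : ι × Bool → A}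
    (hw : w ∈ words (ι × Bool) c) (a : A) : (closedNeighbours w a).card ≤ d + 1 := by
  refine (Finset.card_insert_le _ _).trans (Nat.add_le_add_right ?_ 1)
  refine Finset.card_image_le.trans ?_
  rw [mem_words.mp hw]
  exact hc a

/-- A defect can be removed by swapping two letters, without creating a new one. -/
theorem exists_swap_defects_ssubset {c : A → ℕ} {d K : ℕ} (hc : ∀ a, c a ≤ d)
    {w : ι × Bool → A} (hw : w ∈ words (ι × Bool) c) (hK : (defects w).card ≤ K)
    (hm : K + d * (2 * d + 3) < Fintype.card ι) (hne : (defects w).Nonempty) :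
    ∃ p q, defects (w ∘ Equiv.swap p q) ⊂ defects w := by
  obtain ⟨i, hi⟩ := hne
  set u := w (i, false) with hu
  set v := w (i, true) with hv
  -- Seek a defect-free edge $xy$ with $y$ outside the closed neighbourhood of $u$, and $x\ne u$
  -- outside that of $v$. At most $K+d(d+1)+d(d+2)$ indices are excluded. Switching $uv,xy$ to
  -- $uy,xv$ then creates only new, simple edges.
  have hfew : ((defects w ∪ (Finset.univ.filter fun j => w (j, true) ∈ closedNeighbours w u)) ∪
      (Finset.univ.filter fun j => w (j, false) ∈ insert u (closedNeighbours w v))).card <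
      (Finset.univ : Finset ι).card := by
    have h1 := card_filter_mem_le hc hw (closedNeighbours w u) true
    have h2 := card_filter_mem_le hc hw (insert u (closedNeighbours w v)) false
    have h3 := card_closedNeighbours_le hc hw u
    have h4 := card_closedNeighbours_le hc hw v
    have h5 := Finset.card_insert_le u (closedNeighbours w v)
    have h6 := Finset.card_union_le (defects w)
      (Finset.univ.filter fun j => w (j, true) ∈ closedNeighbours w u)
    have h7 := Finset.card_union_le
      (defects w ∪ (Finset.univ.filter fun j => w (j, true) ∈ closedNeighbours w u))
      (Finset.univ.filter fun j => w (j, false) ∈ insert u (closedNeighbours w v))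
    have h8 := Nat.mul_le_mul_left d h3
    have h9 := Nat.mul_le_mul_left d (h5.trans (Nat.add_le_add_right h4 1))
    rw [Finset.card_univ]
    nlinarith
  obtain ⟨j, -, hj⟩ := Finset.exists_mem_notMem_of_card_lt_card hfew
  simp only [Finset.mem_union, Finset.mem_filter, Finset.mem_univ, true_and, not_or] at hj
  obtain ⟨⟨hj1, hj2⟩, hj3⟩ := hj
  set x := w (j, false) with hx
  set y := w (j, true) with hy
  have hxu : x ≠ u := fun h => hj3 (by simp [h])
  have hxv : x ∉ closedNeighbours w v := fun h => hj3 (Finset.mem_insert_of_mem h)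
  have hxy : x ≠ y := fun h => hj1 (mem_defects.mpr (Or.inl h))
  have hij : i ≠ j := fun h => hj1 (h ▸ hi)
  have hyu' : y ≠ u := fun h => hj2 (by simp [closedNeighbours, h])
  have hxv' : x ≠ v := fun h => hxv (by simp [closedNeighbours, h])
  refine ⟨(i, true), (j, true), ?_⟩
  set w' := w ∘ Equiv.swap (i, true) (j, true) with hw'
  have hfalse : ∀ k, w' (k, false) = w (k, false) := by
    intro k
    rw [hw', Function.comp, Equiv.swap_apply_of_ne_of_ne (by simp) (by simp)]
  have hti : w' (i, true) = y := by simp [hw', hy]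
  have htj : w' (j, true) = v := by simp [hw', hv]
  have hother : ∀ k, k ≠ i → k ≠ j → w' (k, true) = w (k, true) := by
    intro k hki hkj
    rw [hw', Function.comp, Equiv.swap_apply_of_ne_of_ne (by simpa) (by simpa)]
  have ei : wordEdge w' i = s(u, y) := by rw [wordEdge, hfalse, hti]
  have ej : wordEdge w' j = s(v, x) := by rw [wordEdge, hfalse, htj, Sym2.eq_swap]
  have ek : ∀ k, k ≠ i → k ≠ j → wordEdge w' k = wordEdge w k := by
    intro k hki hkj
    rw [wordEdge, hfalse, hother k hki hkj, wordEdge]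
  have hnewi : ∀ k, wordEdge w k ≠ s(u, y) := fun k h =>
    hj2 (mem_closedNeighbours_of_wordEdge_eq h)
  have hnewj : ∀ k, wordEdge w k ≠ s(v, x) := fun k h =>
    hxv (mem_closedNeighbours_of_wordEdge_eq h)
  have hijne : wordEdge w' i ≠ wordEdge w' j := by
    rw [ei, ej, Ne, Sym2.eq_iff]
    rintro (⟨-, h⟩ | ⟨h, -⟩)
    · exact hxy h.symm
    · exact hxu h.symm
  have hi' : i ∉ defects w' := by
    rw [mem_defects, hfalse, hti]
    rintro (h | ⟨l, hl, h⟩)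
    · exact hyu' h.symm
    · by_cases hlj : l = j
      · rw [hlj] at h; exact hijne h.symm
      · rw [ek l hl hlj, ei] at h; exact hnewi l h
  have hj' : j ∉ defects w' := by
    rw [mem_defects, hfalse, htj]
    rintro (h | ⟨l, hl, h⟩)
    · exact hxv' h
    · by_cases hli : l = i
      · rw [hli] at h; exact hijne h
      · rw [ek l hli hl, ej] at h; exact hnewj l h
  refine (Finset.ssubset_iff_of_subset ?_).mpr ⟨i, hi, hi'⟩
  intro k hk
  have hki : k ≠ i := fun h => hi' (h ▸ hk)
  have hkj : k ≠ j := fun h => hj' (h ▸ hk)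
  rw [mem_defects, hfalse, hother k hki hkj] at hk
  refine mem_defects.mpr (hk.imp_right ?_)
  rintro ⟨l, hl, h⟩
  rw [ek k hki hkj] at h
  by_cases hli : l = i
  · rw [hli, ei] at h; exact absurd h.symm (hnewi k)
  by_cases hlj : l = j
  · rw [hlj, ej] at h; exact absurd h.symm (hnewj k)
  exact ⟨l, hl, by rw [← ek l hli hlj, h]⟩

/-- Undoing a switching recovers the word from one with fewer defects and a pair of positions, so
each defect allowed costs a factor $(2m)^2$. -/
theorem card_few_defects_le {c : A → ℕ} {d K : ℕ} (hc : ∀ a, c a ≤ d)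
    (hm : K + d * (2 * d + 3) < Fintype.card ι) (b : ℕ) (hb : b ≤ K) :
    ((words (ι × Bool) c).filter fun w => (defects w).card ≤ b).card ≤
      (2 * Fintype.card ι) ^ (2 * b) *
        ((words (ι × Bool) c).filter fun w => defects w = ∅).card := by
  induction b with
  | zero => simp
  | succ b ih =>
    have hsub : ((words (ι × Bool) c).filter fun w => (defects w).card ≤ b + 1) ⊆
        ((((words (ι × Bool) c).filter fun w => (defects w).card ≤ b) ×ˢ
          (Finset.univ : Finset ((ι × Bool) × (ι × Bool)))).image
            fun t => t.1 ∘ Equiv.swap t.2.1 t.2.2) := by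
      intro w hw
      rw [Finset.mem_filter] at hw
      have hex : ∃ p q, (defects (w ∘ Equiv.swap p q)).card ≤ b := by
        rcases Finset.eq_empty_or_nonempty (defects w) with h | h
        · have : Nonempty ι := Fintype.card_pos_iff.mp (by omega)
          obtain ⟨i⟩ := this
          refine ⟨(i, true), (i, true), ?_⟩
          simp [h]
        · obtain ⟨p, q, hpq⟩ := exists_swap_defects_ssubset hc hw.1 (hw.2.trans hb) hm h
          have := Finset.card_lt_card hpq
          exact ⟨p, q, by omega⟩
      obtain ⟨p, q, hpq⟩ := hex
      refine Finset.mem_image.mpr ⟨(w ∘ Equiv.swap p q, (p, q)), ?_, comp_swap_comp_swap w p q⟩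
      simp only [Finset.mem_product, Finset.mem_filter, Finset.mem_univ, and_true]
      exact ⟨comp_perm_mem_words hw.1 _, hpq⟩
    refine (Finset.card_le_card hsub).trans (Finset.card_image_le.trans ?_)
    rw [Finset.card_product, Finset.card_univ, Fintype.card_prod, Fintype.card_prod,
      Fintype.card_bool]
    calc _ ≤ ((2 * Fintype.card ι) ^ (2 * b) *
        ((words (ι × Bool) c).filter fun w => defects w = ∅).card) *
          (Fintype.card ι * 2 * (Fintype.card ι * 2)) := Nat.mul_le_mul_right _ (ih (by omega))
      _ = _ := by ring

/-- Words without defects make up at least a polynomial fraction of all words. -/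
theorem card_words_le {c : A → ℕ} {d : ℕ} (hd : 0 < d) (hc : ∀ a, c a ≤ d)
    (hm : d * (4 * d + 3) < Fintype.card ι) :
    (words (ι × Bool) c).card ≤ 2 * (2 * Fintype.card ι) ^ (4 * d ^ 2) *
      ((words (ι × Bool) c).filter fun w => defects w = ∅).card := by
  obtain ⟨e, rfl⟩ := Nat.exists_eq_succ_of_ne_zero hd.ne'
  rw [Nat.succ_eq_add_one] at *
  have h1 := sum_card_defects_le hc (by nlinarith)
  -- The average number of defects is at most $e+e^2\le(e+1)^2$, so by Markov at least half of all
  -- words have at most twice $(e+1)^2$.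
  have h2 := card_few_defects_le (K := 2 * (e + 1) ^ 2) hc (by nlinarith) _ le_rfl
  set Ω := words (ι × Bool) c
  set K := 2 * (e + 1) ^ 2 with hKdef
  have h3 := Finset.card_filter_add_card_filter_not (s := Ω) (fun w => (defects w).card ≤ K)
  have h4 : (Ω.filter fun w => ¬ (defects w).card ≤ K).card * K ≤
      ∑ w ∈ Ω, (defects w).card := by
    rw [← smul_eq_mul]
    refine (Finset.card_nsmul_le_sum _ _ _ fun w hw => ?_).trans
      (Finset.sum_le_sum_of_subset (Finset.filter_subset (fun w => ¬ (defects w).card ≤ K) Ω))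
    have := (Finset.mem_filter.mp hw).2
    omega
  have h5 : 2 * (Ω.filter fun w => ¬ (defects w).card ≤ K).card ≤ Ω.card := by
    have hK : (e + e ^ 2) ≤ (e + 1) ^ 2 := by nlinarith
    have := (h4.trans h1).trans (Nat.mul_le_mul_right _ hK)
    refine Nat.le_of_mul_le_mul_left ?_ (show 0 < (e + 1) ^ 2 by positivity)
    calc _ = (Ω.filter fun w => ¬ (defects w).card ≤ K).card * K := by rw [hKdef]; ring
      _ ≤ _ := this
  have h6 : 4 * (e + 1) ^ 2 = 2 * K := by rw [hKdef]; ring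
  rw [h6, mul_assoc]
  omega

end Switching

/-! ### Projecting words to letter classes, and multinomial estimates. -/

section Types

variable {P A B : Type*} [Fintype P] [DecidableEq P] [Fintype A] [DecidableEq A]
  [Fintype B] [DecidableEq B]

theorem exists_perm_comp_eq {c : A → ℕ} {u u' : P → A} (hu : u ∈ words P c)
    (hu' : u' ∈ words P c) : ∃ σ : Equiv.Perm P, u' = u ∘ σ := by
  rw [mem_words] at hu hu'
  have h : ∀ a, Nonempty ({p // u' p = a} ≃ {p // u p = a}) := fun a =>
    Fintype.card_eq.mp (by rw [Fintype.card_subtype, Fintype.card_subtype, hu, hu'])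
  refine ⟨Equiv.ofFiberEquiv fun a => (h a).some, ?_⟩
  funext p
  exact (Equiv.ofFiberEquiv_map (fun a => (h a).some) p).symm

theorem comp_mem_words {c : A → ℕ} {w : P → A} (hw : w ∈ words P c) (τ : A → B) :
    τ ∘ w ∈ words P fun b => ∑ a with τ a = b, c a := by
  rw [mem_words] at *
  intro b
  have : (Finset.univ.filter fun p => (τ ∘ w) p = b) =
      (Finset.univ.filter fun a => τ a = b).biUnion
        fun a => Finset.univ.filter fun p => w p = a := by
    ext p; simp
  rw [this, Finset.card_biUnion]
  · exact Finset.sum_congr rfl fun a _ => hw a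
  · intro a _ a' _ haa'
    rw [Function.onFun, Finset.disjoint_left]
    intro p hp hp'
    simp only [Finset.mem_filter, Finset.mem_univ, true_and] at hp hp'
    exact haa' (hp.symm.trans hp')

theorem card_filter_comp_eq_of_mem_words {c : A → ℕ} {c' : B → ℕ} (τ : A → B) {u u' : P → B}
    (hu : u ∈ words P c') (hu' : u' ∈ words P c') :
    ((words P c).filter fun w => τ ∘ w = u).card =
      ((words P c).filter fun w => τ ∘ w = u').card := by
  obtain ⟨σ, rfl⟩ := exists_perm_comp_eq hu hu'
  refine Finset.card_nbij' (fun w => w ∘ σ) (fun w => w ∘ σ.symm) ?_ ?_ ?_ ?_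
  · intro w hw
    simp only [Finset.coe_filter, Set.mem_ofPred_eq] at hw ⊢
    exact ⟨comp_perm_mem_words hw.1 σ, by rw [← hw.2]; rfl⟩
  · intro w hw
    simp only [Finset.coe_filter, Set.mem_ofPred_eq] at hw ⊢
    refine ⟨comp_perm_mem_words hw.1 σ.symm, ?_⟩
    rw [← Function.comp_assoc, hw.2]
    funext p; simp
  · intro w _; funext p; simp
  · intro w _; funext p; simp

/-- A uniformly random word induces a uniformly random word of letter classes. -/
theorem card_filter_comp_mul_card {c : A → ℕ} (τ : A → B) (Q : (P → B) → Prop)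
    [DecidablePred Q] :
    ((words P c).filter fun w => Q (τ ∘ w)).card *
        (words P fun b => ∑ a with τ a = b, c a).card =
      ((words P fun b => ∑ a with τ a = b, c a).filter Q).card * (words P c).card := by
  set U := words P fun b => ∑ a with τ a = b, c a with hU
  have hmaps : ∀ w ∈ words P c, τ ∘ w ∈ U := fun w hw => comp_mem_words hw τ
  -- Words with equal letter counts differ by a permutation of positions, which carries one fibre of
  -- $w\mapsto\tau\circ w$ onto another.
  have hF : ∃ F, ∀ u ∈ U, ((words P c).filter fun w => τ ∘ w = u).card = F := by
    rcases U.eq_empty_or_nonempty with h | ⟨u₀, h₀⟩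
    · exact ⟨0, by simp [h]⟩
    · exact ⟨_, fun u hu => card_filter_comp_eq_of_mem_words τ hu h₀⟩
  obtain ⟨F, hF⟩ := hF
  have h1 : (words P c).card = U.card * F := by
    rw [Finset.card_eq_sum_card_fiberwise hmaps, Finset.sum_congr rfl hF, Finset.sum_const,
      smul_eq_mul]
  have h2 : ((words P c).filter fun w => Q (τ ∘ w)).card = (U.filter Q).card * F := by
    have hmaps' : ∀ w ∈ (words P c).filter fun w => Q (τ ∘ w), τ ∘ w ∈ U.filter Q := by
      intro w hw
      rw [Finset.mem_filter] at hw ⊢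
      exact ⟨hmaps w hw.1, hw.2⟩
    rw [Finset.card_eq_sum_card_fiberwise hmaps', ← smul_eq_mul, ← Finset.sum_const]
    refine Finset.sum_congr rfl fun u hu => ?_
    rw [Finset.mem_filter] at hu
    rw [← hF u hu.1, Finset.filter_filter]
    congr 1
    refine Finset.filter_congr fun w _ => ?_
    constructor
    · exact fun h => h.2
    · rintro rfl; exact ⟨hu.2, rfl⟩
  rw [h1, h2]; ring

theorem prod_comp_eq_of_mem_words {c : A → ℕ} {w : P → A} (hw : w ∈ words P c) (x : A → ℝ) :
    ∏ p, x (w p) = ∏ a, x a ^ c a := by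
  rw [Finset.prod_comp x w]
  rw [mem_words] at hw
  simp_rw [hw]
  refine Finset.prod_subset (Finset.subset_univ _) fun a _ ha => ?_
  rw [← hw a, Finset.card_eq_zero.mpr, pow_zero]
  rw [Finset.filter_eq_empty_iff]
  rintro p - rfl
  exact ha (Finset.mem_image_of_mem _ (Finset.mem_univ p))

/-- Expand the power over all words and keep only those with letter counts `c`. -/
theorem card_words_mul_prod_pow_le (c : A → ℕ) {x : A → ℝ} (hx : ∀ a, 0 ≤ x a) :
    ((words P c).card : ℝ) * ∏ a, x a ^ c a ≤ (∑ a, x a) ^ Fintype.card P := by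
  have h1 : ∑ w : P → A, ∏ p, x (w p) = (∑ a, x a) ^ Fintype.card P := by
    rw [← Finset.card_univ, ← Finset.prod_const, Finset.prod_univ_sum, Fintype.piFinset_univ]
  rw [← h1, ← nsmul_eq_mul, ← Finset.sum_const]
  calc _ = ∑ w ∈ words P c, ∏ p, x (w p) :=
        Finset.sum_congr rfl fun w hw => (prod_comp_eq_of_mem_words hw x).symm
    _ ≤ _ := Finset.sum_le_sum_of_subset_of_nonneg (Finset.subset_univ _)
        fun w _ _ => Finset.prod_nonneg fun p _ => hx _

/-- Choose the positions of the letters 0 and 1 together, then those of 0 among them. -/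
theorem choose_mul_choose_le_card_words (c : Fin 3 → ℕ)
    (hc : c 0 + c 1 + c 2 = Fintype.card P) :
    (Fintype.card P).choose (c 0 + c 1) * (c 0 + c 1).choose (c 0) ≤ (words P c).card := by
  let X : Finset (Σ _ : Finset P, Finset P) :=
    (Finset.powersetCard (c 0 + c 1) Finset.univ).sigma fun S => Finset.powersetCard (c 0) S
  have hX : X.card = (Fintype.card P).choose (c 0 + c 1) * (c 0 + c 1).choose (c 0) := by
    rw [Finset.card_sigma, Finset.sum_congr rfl (g := fun _ => (c 0 + c 1).choose (c 0)),
      Finset.sum_const, Finset.card_powersetCard, Finset.card_univ, smul_eq_mul]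
    intro S hS
    rw [Finset.card_powersetCard, (Finset.mem_powersetCard.mp hS).2]
  rw [← hX]
  let f : (Σ _ : Finset P, Finset P) → P → Fin 3 := fun s p =>
    if p ∈ s.2 then 0 else if p ∈ s.1 then 1 else 2
  have hf0 : ∀ s p, f s p = 0 ↔ p ∈ s.2 := by
    intro s p; simp only [f]; split_ifs <;> simp_all
  have hf1 : ∀ s p, f s p = 1 ↔ p ∈ s.1 \ s.2 := by
    intro s p; simp only [f]; split_ifs <;> simp_all
  have hf2 : ∀ s ∈ X, ∀ p, f s p = 2 ↔ p ∈ s.1ᶜ := by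
    intro s hs p
    have : s.2 ⊆ s.1 := by
      simp only [X, Finset.mem_sigma, Finset.mem_powersetCard] at hs; exact hs.2.1
    have := @this p
    simp only [f]; split_ifs <;> simp_all
  refine Finset.card_le_card_of_injOn f ?_ ?_
  · intro s hs
    have hs' := hs
    simp only [X, Finset.mem_coe, Finset.mem_sigma, Finset.mem_powersetCard] at hs'
    rw [Finset.mem_coe, mem_words]
    intro a
    fin_cases a
    · simp [hf0, hs'.2.2]
    · simp only [Fin.mk_one, hf1, Finset.filter_univ_mem]
      rw [Finset.card_sdiff_of_subset hs'.2.1, hs'.2.2, hs'.1.2]; simp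
    · simp only [Fin.reduceFinMk, hf2 s hs, Finset.filter_univ_mem]
      rw [Finset.card_compl, hs'.1.2]; omega
  · intro s hs t ht hst
    have h2 : s.2 = t.2 := by
      ext p; rw [← hf0, ← hf0, hst]
    have h1 : s.1 = t.1 := by
      ext p
      have := hf2 s hs p
      have h' := hf2 t ht p
      rw [hst, h', Finset.mem_compl, Finset.mem_compl, not_iff_not] at this
      exact this.symm
    exact Sigma.ext h1 (heq_of_eq h2)

end Types

/-! ### Three-letter words with few crossing edges. -/

section Sparse

variable {ι : Type*} [Fintype ι] [DecidableEq ι]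

/-- The number of edges of a word between the classes `0` and `1`. -/
def crossing {ι : Type*} [Fintype ι] (u : ι × Bool → Fin 3) : ℕ :=
  (Finset.univ.filter fun i => wordEdge u i = s(0, 1)).card

/-- An exponential moment bound for the number of words with few crossing edges. -/
theorem card_sparse_mul_le (c : Fin 3 → ℕ) (n : ℕ) {ξ θ : ℝ} (hξ : 0 ≤ ξ) (hθ : 0 ≤ θ)
    (hθ1 : θ ≤ 1) :
    (((words (ι × Bool) c).filter fun u => crossing u < n).card : ℝ) *
        (θ ^ n * ξ ^ (c 0 + c 1)) ≤
      (1 + 4 * ξ + (2 + 2 * θ) * ξ ^ 2) ^ Fintype.card ι := by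
  -- Letters 0 and 1 weigh `ξ`, and each crossing edge gets an extra factor `θ`. The total weight of
  -- all words factorises over the edges, while a sparse word weighs at least
  -- $\theta^n\xi^{c_0+c_1}$.
  set x : Fin 3 → ℝ := ![ξ, ξ, 1] with hx
  have hx0 : ∀ a, 0 ≤ x a := by
    intro a; fin_cases a <;> simp [hx, hξ]
  set g : Fin 3 × Fin 3 → ℝ := fun t => (if s(t.1, t.2) = s(0, 1) then θ else 1) *
    (x t.1 * x t.2) with hg
  have hg0 : ∀ t, 0 ≤ g t := by
    intro t
    simp only [hg]
    exact mul_nonneg (by split_ifs <;> linarith) (mul_nonneg (hx0 _) (hx0 _))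
  have hsum : ∑ t, g t = 1 + 4 * ξ + (2 + 2 * θ) * ξ ^ 2 := by
    simp only [hg, Fintype.sum_prod_type, Fin.sum_univ_three, hx]
    simp
    ring
  have htot : ∑ u : ι × Bool → Fin 3, ∏ i, g (u (i, false), u (i, true)) =
      (1 + 4 * ξ + (2 + 2 * θ) * ξ ^ 2) ^ Fintype.card ι := by
    rw [← hsum, ← Finset.card_univ, ← Finset.prod_const, Finset.prod_univ_sum,
      Fintype.piFinset_univ]
    refine Fintype.sum_bijective (fun (u : ι × Bool → Fin 3) i => (u (i, false), u (i, true)))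
      ⟨?_, ?_⟩ _ _ fun _ => rfl
    · intro u v huv
      funext ⟨i, β⟩
      have := congrFun huv i
      simp only [Prod.mk.injEq] at this
      cases β
      · exact this.1
      · exact this.2
    · intro v
      exact ⟨fun p => if p.2 then (v p.1).2 else (v p.1).1, by funext i; simp⟩
  rw [← htot, ← nsmul_eq_mul, ← Finset.sum_const]
  refine (Finset.sum_le_sum fun u hu => ?_).trans (Finset.sum_le_sum_of_subset_of_nonneg
    (Finset.subset_univ _) fun u _ _ => Finset.prod_nonneg fun i _ => hg0 _)
  rw [Finset.mem_filter] at hu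
  have hprod : ∏ i, (x (u (i, false)) * x (u (i, true))) = ξ ^ (c 0 + c 1) := by
    have h1 := prod_comp_eq_of_mem_words hu.1 x
    rw [Fintype.prod_prod_type] at h1
    simp only [Fintype.prod_bool, Fin.prod_univ_three] at h1
    rw [pow_add]
    simpa [hx, mul_comm] using h1
  simp only [hg, Finset.prod_mul_distrib (f := fun i => if s(u (i, false), u (i, true)) = s(0, 1)
    then θ else (1 : ℝ))]
  rw [hprod]
  refine mul_le_mul_of_nonneg_right ?_ (by positivity)
  rw [Finset.prod_ite, Finset.prod_const, Finset.prod_const_one, mul_one]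
  exact pow_le_pow_of_le_one hθ hθ1 hu.2.le

end Sparse

/-! ### Simple graphs as defect-free words. -/

section GraphWords

variable {ι V : Type*} [Fintype ι] [DecidableEq ι] [Fintype V] [DecidableEq V]

open Classical in
/-- The words whose edges are precisely the edges of `G`, without repetition. -/
noncomputable def graphWords (ι : Type*) {V : Type*} [Fintype ι] [DecidableEq ι] [Fintype V]
    [DecidableEq V] (G : SimpleGraph V) : Finset (ι × Bool → V) :=
  Finset.univ.filter fun w => Function.Injective (wordEdge w) ∧ Set.range (wordEdge w) = G.edgeSet

theorem mem_graphWords {G : SimpleGraph V} {w : ι × Bool → V} :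
    w ∈ graphWords ι G ↔
      Function.Injective (wordEdge w) ∧ Set.range (wordEdge w) = G.edgeSet := by
  simp [graphWords]

theorem eq_of_mem_graphWords {G H : SimpleGraph V} {w : ι × Bool → V} (hG : w ∈ graphWords ι G)
    (hH : w ∈ graphWords ι H) : G = H := by
  rw [mem_graphWords] at hG hH
  exact SimpleGraph.edgeSet_injective (hG.2.symm.trans hH.2)

theorem adj_of_mem_graphWords {G : SimpleGraph V} {w : ι × Bool → V} (hw : w ∈ graphWords ι G)
    (i : ι) : G.Adj (w (i, false)) (w (i, true)) := by
  have : wordEdge w i ∈ G.edgeSet := (mem_graphWords.mp hw).2 ▸ Set.mem_range_self i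
  exact this

theorem card_filter_pair_eq_two {e : Sym2 V} (he : ¬ e.IsDiag) :
    (Finset.univ.filter fun t : V × V => s(t.1, t.2) = e).card = 2 := by
  induction e using Sym2.ind with
  | _ a b =>
    rw [Sym2.mk_isDiag_iff] at he
    rw [Finset.card_eq_two]
    refine ⟨(a, b), (b, a), fun h => he (congrArg Prod.fst h), ?_⟩
    ext ⟨x, y⟩
    simp [Prod.ext_iff]

theorem card_filter_wordEdge_eq {f : ι → Sym2 V} (hf : ∀ i, ¬ (f i).IsDiag) :
    (Finset.univ.filter fun w : ι × Bool → V => wordEdge w = f).card = 2 ^ Fintype.card ι := by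
  have h : (Fintype.piFinset fun i => Finset.univ.filter fun t : V × V => s(t.1, t.2) = f i).card =
      2 ^ Fintype.card ι := by
    rw [Fintype.card_piFinset, Finset.prod_congr rfl fun i _ => card_filter_pair_eq_two (hf i),
      Finset.prod_const, Finset.card_univ]
  rw [← h]
  refine Finset.card_nbij' (fun w i => (w (i, false), w (i, true)))
    (fun v p => if p.2 then (v p.1).2 else (v p.1).1) ?_ ?_ ?_ ?_
  · intro w hw
    simp only [Finset.coe_filter, Finset.mem_univ, true_and, Set.mem_ofPred_eq] at hw
    simp [← hw, wordEdge]
  · intro v hv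
    simp only [Finset.mem_coe, Fintype.mem_piFinset, Finset.mem_filter, Finset.mem_univ,
      true_and] at hv ⊢
    funext i
    simpa [wordEdge] using hv i
  · intro w _
    funext ⟨i, β⟩
    cases β <;> simp
  · intro v _
    funext i
    simp

open Classical in
theorem card_filter_bijOn_range (E : Finset (Sym2 V)) (hE : E.card = Fintype.card ι) :
    (Finset.univ.filter fun f : ι → Sym2 V =>
      Function.Injective f ∧ Set.range f = E).card = (Fintype.card ι).factorial := by
  have e : ι ≃ E := Fintype.equivOfCardEq (by rw [Fintype.card_coe, hE])
  rw [← Fintype.card_equiv e, ← Finset.card_univ]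
  symm
  refine Finset.card_bij (fun (g : ι ≃ E) _ i => (g i : Sym2 V)) ?_ ?_ ?_
  · intro g _
    simp only [Finset.mem_filter, Finset.mem_univ, true_and]
    refine ⟨Subtype.val_injective.comp g.injective, ?_⟩
    ext x
    constructor
    · rintro ⟨i, rfl⟩; exact (g i).2
    · intro hx; exact ⟨g.symm ⟨x, hx⟩, by simp⟩
  · intro g _ g' _ h
    exact Equiv.ext fun i => Subtype.ext (congrFun h i)
  · intro f hf
    simp only [Finset.mem_filter, Finset.mem_univ, true_and] at hf
    have hmem : ∀ i, f i ∈ E := fun i => by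
      have : f i ∈ Set.range f := Set.mem_range_self i
      rw [hf.2] at this; exact this
    refine ⟨Equiv.ofBijective (fun i => ⟨f i, hmem i⟩) ⟨?_, ?_⟩, Finset.mem_univ _, rfl⟩
    · intro i j hij
      exact hf.1 (congrArg Subtype.val hij)
    · rintro ⟨x, hx⟩
      have : x ∈ Set.range f := by rw [hf.2]; exact hx
      obtain ⟨i, hi⟩ := this
      exact ⟨i, Subtype.ext hi⟩

/-- Such a word is an ordering of the edges together with an orientation of each. -/
theorem card_graphWords {G : SimpleGraph V} [Fintype G.edgeSet]
    (hG : G.edgeFinset.card = Fintype.card ι) :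
    (graphWords ι G).card = (Fintype.card ι).factorial * 2 ^ Fintype.card ι := by
  classical
  rw [← card_filter_bijOn_range G.edgeFinset hG]
  have hmaps : ∀ w ∈ graphWords ι G, wordEdge w ∈ Finset.univ.filter fun f : ι → Sym2 V =>
      Function.Injective f ∧ Set.range f = G.edgeFinset := by
    intro w hw
    rw [mem_graphWords] at hw
    simpa using hw
  rw [Finset.card_eq_sum_card_fiberwise hmaps, ← smul_eq_mul, ← Finset.sum_const]
  refine Finset.sum_congr rfl fun f hf => ?_
  simp only [Finset.mem_filter, Finset.mem_univ, true_and, SimpleGraph.coe_edgeFinset] at hf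
  rw [← card_filter_wordEdge_eq (f := f)]
  · congr 1
    ext w
    simp only [Finset.mem_filter, Finset.mem_univ, true_and, mem_graphWords]
    constructor
    · exact fun h => h.2
    · rintro rfl; exact ⟨hf, rfl⟩
  · intro i
    have : f i ∈ G.edgeSet := hf.2 ▸ Set.mem_range_self i
    exact G.not_isDiag_of_mem_edgeSet this

theorem card_filter_eq_degree {G : SimpleGraph V} [DecidableRel G.Adj] {w : ι × Bool → V}
    (hw : w ∈ graphWords ι G) (v : V) :
    (Finset.univ.filter fun p => w p = v).card = G.degree v := by
  have hw' := mem_graphWords.mp hw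
  rw [← SimpleGraph.card_incidenceFinset_eq_degree]
  refine Finset.card_bij (fun p _ => wordEdge w p.1) ?_ ?_ ?_
  · rintro ⟨i, β⟩ hp
    simp only [Finset.mem_filter, Finset.mem_univ, true_and] at hp
    rw [SimpleGraph.mem_incidenceFinset]
    refine ⟨hw'.2 ▸ Set.mem_range_self i, ?_⟩
    cases β <;> simp [wordEdge, hp]
  · rintro ⟨i, β⟩ hp ⟨j, γ⟩ hq h
    simp only [Finset.mem_filter, Finset.mem_univ, true_and] at hp hq
    have hij : i = j := hw'.1 h
    subst hij
    have hne := (adj_of_mem_graphWords hw i).ne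
    cases β <;> cases γ <;> simp_all
  · intro e he
    rw [SimpleGraph.mem_incidenceFinset] at he
    have : e ∈ Set.range (wordEdge w) := by rw [hw'.2]; exact he.1
    obtain ⟨i, rfl⟩ := this
    rcases Sym2.mem_iff.mp he.2 with h | h
    · exact ⟨(i, false), by simp [h], rfl⟩
    · exact ⟨(i, true), by simp [h], rfl⟩

theorem graphWords_subset_words {G : SimpleGraph V} [G.LocallyFinite] {d : ℕ}
    (hG : G.IsRegularOfDegree d) : graphWords ι G ⊆ words (ι × Bool) fun _ => d := by
  classical
  intro w hw
  rw [mem_words]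
  intro v
  rw [card_filter_eq_degree hw]
  convert hG v

open Classical in
theorem exists_mem_graphWords {d : ℕ} {w : ι × Bool → V}
    (hw : w ∈ words (ι × Bool) fun _ => d) (hdef : defects w = ∅) :
    ∃ G : SimpleGraph V, G.IsRegularOfDegree d ∧ w ∈ graphWords ι G := by
  suffices h : ∃ G : SimpleGraph V, w ∈ graphWords ι G by
    obtain ⟨G, hG⟩ := h
    refine ⟨G, fun v => ?_, hG⟩
    have := card_filter_eq_degree hG v
    rw [mem_words.mp hw v] at this
    convert this.symm
  have hnot : ∀ i, i ∉ defects w := by simp [hdef]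
  simp only [mem_defects, not_or, not_exists, not_and] at hnot
  refine ⟨SimpleGraph.fromEdgeSet (Set.range (wordEdge w)), mem_graphWords.mpr ⟨?_, ?_⟩⟩
  · intro i j hij
    by_contra hne
    exact (hnot j).2 i hne hij
  · rw [SimpleGraph.edgeSet_fromEdgeSet, eq_comm, sdiff_eq_left, Set.disjoint_left]
    rintro _ ⟨i, rfl⟩ h
    exact (hnot i).1 (by simpa [wordEdge] using h)

theorem card_edgeFinset_of_isRegularOfDegree {V : Type*} [Fintype V] {G : SimpleGraph V}
    [DecidableRel G.Adj] {d : ℕ}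
    (hG : G.IsRegularOfDegree d) : 2 * G.edgeFinset.card = d * Fintype.card V := by
  rw [← SimpleGraph.sum_degrees_eq_twice_card_edges, Finset.sum_congr rfl fun v _ => hG v]
  simp [mul_comm]

end GraphWords

/-! ### The union bound over pairs of sets. -/

section Counting

theorem words_const_nonempty {P A : Type*} [Fintype P] [DecidableEq P] [Fintype A]
    [DecidableEq A] {d : ℕ} (h : Fintype.card P = Fintype.card A * d) :
    (words P fun _ : A => d).Nonempty := by
  have e : P ≃ A × Fin d := Fintype.equivOfCardEq (by rw [h, Fintype.card_prod, Fintype.card_fin])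
  refine ⟨fun p => (e p).1, mem_words.mpr fun a => ?_⟩
  refine (Finset.card_nbij' (t := Finset.univ) (fun p => (e p).2) (fun i => e.symm (a, i))
    ?_ ?_ ?_ ?_).trans (Finset.card_fin d)
  · simp
  · intro i _
    simp
  · intro p hp
    simp only [Finset.coe_filter, Finset.mem_univ, true_and, Set.mem_ofPred_eq] at hp
    rw [← hp]; simp
  · intro i _
    simp

open Classical in
theorem exists_isRegularOfDegree {n d : ℕ} (hd : 0 < d) (hm : 4 * d + 3 < n) :
    ∃ G : SimpleGraph (Fin (2 * n)), G.IsRegularOfDegree d := by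
  have h := card_words_le (ι := Fin (d * n)) (c := fun _ : Fin (2 * n) => d) hd (fun _ => le_rfl)
    (by rw [Fintype.card_fin]; exact Nat.mul_lt_mul_of_pos_left hm hd)
  have hne := words_const_nonempty (P := Fin (d * n) × Bool) (A := Fin (2 * n)) (d := d)
    (by simp; ring)
  have hpos : 0 < ((words (Fin (d * n) × Bool) fun _ : Fin (2 * n) => d).filter
      fun w => defects w = ∅).card := by
    by_contra h0
    rw [Nat.eq_zero_of_not_pos h0, mul_zero] at h
    have := Finset.card_pos.mpr hne
    omega
  obtain ⟨w, hw⟩ := Finset.card_pos.mp hpos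
  rw [Finset.mem_filter] at hw
  obtain ⟨G, hG, -⟩ := exists_mem_graphWords hw.1 hw.2
  exact ⟨G, hG⟩

open Classical in
/-- The proportion of regular graphs without the Ramsey property, in terms of words in three
letters. -/
theorem card_not_arrows_mul_le {n d : ℕ} (hn : 0 < n) (hd : 0 < d) (hm : 4 * d + 3 < n) :
    ((Finset.univ : Finset (SimpleGraph (Fin (2 * n)))).filter fun G => G.IsRegularOfDegree d ∧
        ¬ Arrows G (cyclesUpTo n) (SimpleGraph.pathGraph n)).card *
      (words (Fin (d * n) × Bool) fun b => d * ![n / 2, n - n / 2, n] b).card ≤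
    2 * (2 * (d * n)) ^ (4 * d ^ 2) * (words (Fin (2 * n)) ![n / 2, n - n / 2, n]).card *
      ((words (Fin (d * n) × Bool) fun b => d * ![n / 2, n - n / 2, n] b).filter
        fun u => crossing u < n).card *
      ((Finset.univ : Finset (SimpleGraph (Fin (2 * n)))).filter
        fun G => G.IsRegularOfDegree d).card := by
  set reg := (Finset.univ : Finset (SimpleGraph (Fin (2 * n)))).filter
    fun G => G.IsRegularOfDegree d with hreg
  set bad := (Finset.univ : Finset (SimpleGraph (Fin (2 * n)))).filter
    fun G => G.IsRegularOfDegree d ∧ ¬ Arrows G (cyclesUpTo n) (SimpleGraph.pathGraph n) with hbad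
  set c : Fin 3 → ℕ := ![n / 2, n - n / 2, n] with hc
  set U := words (Fin (d * n) × Bool) fun b => d * c b with hU
  set Ω := words (Fin (d * n) × Bool) fun _ : Fin (2 * n) => d with hΩ
  set F := (Fintype.card (Fin (d * n))).factorial * 2 ^ Fintype.card (Fin (d * n)) with hF
  have hFpos : 0 < F := by positivity
  have hcardF : ∀ G ∈ reg, (graphWords (Fin (d * n)) G).card = F := by
    intro G hG
    have hG' : G.IsRegularOfDegree d := (Finset.mem_filter.mp hG).2
    refine card_graphWords ?_
    have h := card_edgeFinset_of_isRegularOfDegree hG'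
    rw [Fintype.card_fin] at *
    refine Nat.eq_of_mul_eq_mul_left two_pos ?_
    rw [h]; ring
  have hdisj : ∀ X : Finset (SimpleGraph (Fin (2 * n))),
      (X : Set (SimpleGraph (Fin (2 * n)))).PairwiseDisjoint (graphWords (Fin (d * n))) := by
    intro X G _ H _ hGH
    rw [Function.onFun, Finset.disjoint_left]
    exact fun w hw hw' => hGH (eq_of_mem_graphWords hw hw')
  have hcount : ∀ X ⊆ reg, (X.biUnion (graphWords (Fin (d * n)))).card = X.card * F := by
    intro X hX
    rw [Finset.card_biUnion (hdisj X), Finset.sum_congr rfl fun G hG => hcardF G (hX hG),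
      Finset.sum_const, smul_eq_mul]
  have hbadreg : bad ⊆ reg := fun G hG => by
    rw [hbad, Finset.mem_filter] at hG
    rw [hreg, Finset.mem_filter]
    exact ⟨hG.1, hG.2.1⟩
  have hsimple : (Ω.filter fun w => defects w = ∅).card ≤ reg.card * F := by
    rw [← hcount reg subset_rfl]
    refine Finset.card_le_card fun w hw => ?_
    rw [Finset.mem_filter] at hw
    obtain ⟨G, hreg', hG⟩ := exists_mem_graphWords hw.1 hw.2
    refine Finset.mem_biUnion.mpr ⟨G, ?_, hG⟩
    rw [hreg, Finset.mem_filter]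
    exact ⟨Finset.mem_univ _, hreg'⟩
  have hall : Ω.card ≤ 2 * (2 * (d * n)) ^ (4 * d ^ 2) * (reg.card * F) := by
    have := card_words_le (ι := Fin (d * n)) (c := fun _ : Fin (2 * n) => d) hd (fun _ => le_rfl)
      (by rw [Fintype.card_fin]; exact Nat.mul_lt_mul_of_pos_left hm hd)
    rw [Fintype.card_fin] at this
    exact this.trans (Nat.mul_le_mul_left _ hsimple)
  -- The class sizes alone determine the proportion of sparse words, so the union bound is this
  -- proportion times the number of partitions.
  have hτ : ∀ τ ∈ words (Fin (2 * n)) c,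
      (Ω.filter fun w => crossing (τ ∘ w) < n).card * U.card =
        (U.filter fun u => crossing u < n).card * Ω.card := by
    intro τ hτ
    have h := card_filter_comp_mul_card (P := Fin (d * n) × Bool) (c := fun _ : Fin (2 * n) => d)
      τ fun u => crossing u < n
    have hcc : (fun b => ∑ a : Fin (2 * n) with τ a = b, d) = fun b => d * c b := by
      funext b
      rw [Finset.sum_const, mem_words.mp hτ b, smul_eq_mul, mul_comm]
    rwa [hcc] at h
  have hunion : bad.card * F ≤
      ∑ τ ∈ words (Fin (2 * n)) c, (Ω.filter fun w => crossing (τ ∘ w) < n).card := by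
    rw [← hcount bad hbadreg]
    refine (Finset.card_le_card (fun w hw => ?_)).trans Finset.card_biUnion_le
    rw [Finset.mem_biUnion] at hw
    obtain ⟨G, hG, hwG⟩ := hw
    rw [hbad, Finset.mem_filter] at hG
    obtain ⟨τ, h0, h1, hE⟩ := exists_sparse_of_not_arrows hn (by simp) hG.2.2
    refine Finset.mem_biUnion.mpr ⟨τ, ?_, Finset.mem_filter.mpr
      ⟨graphWords_subset_words hG.2.1 hwG, ?_⟩⟩
    · rw [mem_words]
      have h2 : (Finset.univ.filter fun v => τ v = 0).card +
          (Finset.univ.filter fun v => τ v = 1).card +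
          (Finset.univ.filter fun v => τ v = 2).card = 2 * n := by
        have := Finset.card_eq_sum_card_fiberwise (f := τ) (s := Finset.univ) (t := Finset.univ)
          (fun _ _ => Finset.mem_univ _)
        rw [Fin.sum_univ_three, Finset.card_univ, Fintype.card_fin] at this
        exact this.symm
      intro a
      fin_cases a
      · simpa [hc] using h0
      · simpa [hc] using h1
      · rw [h0, h1] at h2
        simp only [Fin.reduceFinMk, hc]
        have : (![n / 2, n - n / 2, n] : Fin 3 → ℕ) 2 = n := rfl
        rw [this]
        omega
    · have hw' := mem_graphWords.mp hwG
      -- As `wordEdge w` is injective, crossing indices correspond to distinct crossing edges of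
      -- `G`.
      have := hE ((Finset.univ.filter fun i => wordEdge (τ ∘ w) i = s(0, 1)).image (wordEdge w)) ?_
      · rwa [Finset.card_image_of_injective _ hw'.1] at this
      · intro e he
        obtain ⟨i, hi, rfl⟩ := Finset.mem_image.mp he
        exact ⟨hw'.2 ▸ Set.mem_range_self i, (Finset.mem_filter.mp hi).2⟩
  refine Nat.le_of_mul_le_mul_right ?_ hFpos
  calc bad.card * U.card * F = bad.card * F * U.card := by ring
    _ ≤ (∑ τ ∈ words (Fin (2 * n)) c, (Ω.filter fun w => crossing (τ ∘ w) < n).card) * U.card :=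
        Nat.mul_le_mul_right _ hunion
    _ = (words (Fin (2 * n)) c).card * ((U.filter fun u => crossing u < n).card * Ω.card) := by
        rw [Finset.sum_mul, Finset.sum_congr rfl hτ, Finset.sum_const, smul_eq_mul]
    _ ≤ (words (Fin (2 * n)) c).card * ((U.filter fun u => crossing u < n).card *
          (2 * (2 * (d * n)) ^ (4 * d ^ 2) * (reg.card * F))) :=
        Nat.mul_le_mul_left _ (Nat.mul_le_mul_left _ hall)
    _ = _ := by ring

end Counting

/-! ### Exponential decay of the failure ratio. -/

section Asymptotics

theorem choose_add_le (M k i : ℕ) : M.choose (k + i) ≤ M ^ i * M.choose k := by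
  induction i with
  | zero => simp
  | succ i ih =>
    have h := Nat.choose_succ_right_eq M (k + i)
    calc M.choose (k + (i + 1)) ≤ M.choose (k + i + 1) * (k + i + 1) :=
          Nat.le_mul_of_pos_right _ (by omega)
      _ = M.choose (k + i) * (M - (k + i)) := h
      _ ≤ M ^ i * M.choose k * M := Nat.mul_le_mul ih (Nat.sub_le _ _)
      _ = _ := by ring

theorem two_pow_le_mul_choose_middle (M : ℕ) : 2 ^ M ≤ (M + 1) * M.choose (M / 2) := by
  rw [← Nat.sum_range_choose]
  calc _ ≤ ∑ _i ∈ Finset.range (M + 1), M.choose (M / 2) :=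
        Finset.sum_le_sum fun i _ => Nat.choose_le_middle i M
    _ = _ := by rw [Finset.sum_const, Finset.card_range, smul_eq_mul]

/-- With $M=dn$ the count is at least $\binom{2M}{M}\binom{M}{d\lfloor n/2\rfloor}$. The first
factor is central; the second is at most $d$ steps from the middle, each costing a factor at most
$M$. -/
theorem eight_pow_le_mul_card_words (n d : ℕ) (hn : 0 < n) :
    8 ^ (d * n) ≤ (2 * (d * n) + 1) ^ (d + 2) *
      (words (Fin (d * n) × Bool) fun b => d * ![n / 2, n - n / 2, n] b).card := by
  have h := choose_mul_choose_le_card_words (P := Fin (d * n) × Bool)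
    (fun b => d * ![n / 2, n - n / 2, n] b)
  have e0 : (![n / 2, n - n / 2, n] : Fin 3 → ℕ) 0 = n / 2 := rfl
  have e1 : (![n / 2, n - n / 2, n] : Fin 3 → ℕ) 1 = n - n / 2 := rfl
  have e2 : (![n / 2, n - n / 2, n] : Fin 3 → ℕ) 2 = n := rfl
  have e3 : d * (n / 2) + d * (n - n / 2) = d * n := by
    rw [← mul_add]; congr 1; omega
  simp only [e0, e1, e2, e3, Fintype.card_prod, Fintype.card_fin, Fintype.card_bool] at h
  have h := h (by ring)
  generalize (words (Fin (d * n) × Bool) fun b => d * ![n / 2, n - n / 2, n] b).card = U at h ⊢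
  generalize hM : d * n = M at h ⊢
  have h1 := two_pow_le_mul_choose_middle (M * 2)
  rw [Nat.mul_div_cancel _ two_pos] at h1
  have h2 := two_pow_le_mul_choose_middle M
  obtain ⟨i, hi⟩ : ∃ i, M / 2 = d * (n / 2) + i := by
    refine Nat.exists_eq_add_of_le ?_
    rw [Nat.le_div_iff_mul_le two_pos, mul_assoc, ← hM]
    exact Nat.mul_le_mul_left _ (Nat.div_mul_le_self n 2)
  have hid : i ≤ d := by
    have h3 : n ≤ 2 * (n / 2) + 1 := by omega
    have h4 : M ≤ d * (2 * (n / 2) + 1) := hM ▸ Nat.mul_le_mul_left _ h3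
    have h5 : d * (2 * (n / 2) + 1) = 2 * (d * (n / 2)) + d := by ring
    omega
  have h3 := choose_add_le M (d * (n / 2)) i
  rw [← hi] at h3
  have h4 : M ^ i ≤ (2 * M + 1) ^ d :=
    (Nat.pow_le_pow_left (by omega) i).trans (Nat.pow_le_pow_right (by omega) hid)
  calc 8 ^ M = 2 ^ (M * 2) * 2 ^ M := by
        rw [mul_comm M 2, pow_mul, ← mul_pow]; norm_num
    _ ≤ ((M * 2 + 1) * (M * 2).choose M) * ((M + 1) * ((2 * M + 1) ^ d *
          M.choose (d * (n / 2)))) :=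
        Nat.mul_le_mul h1 (h2.trans (Nat.mul_le_mul_left _ (h3.trans (Nat.mul_le_mul_right _ h4))))
    _ = ((M * 2 + 1) * (M + 1) * (2 * M + 1) ^ d) *
          ((M * 2).choose M * M.choose (d * (n / 2))) := by ring
    _ ≤ ((2 * M + 1) * (2 * M + 1) * (2 * M + 1) ^ d) * U := by
        refine Nat.mul_le_mul (Nat.mul_le_mul_right _ (Nat.mul_le_mul ?_ ?_)) h <;> omega
    _ = _ := by ring

theorem card_words_partition_le (n : ℕ) :
    ((words (Fin (2 * n)) ![n / 2, n - n / 2, n]).card : ℝ) ≤ 8 ^ n := by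
  -- The weights are the limiting class frequencies: they sum to 1, and every word weighs exactly
  -- $4^{-n}2^{-n}=8^{-n}$.
  have h := card_words_mul_prod_pow_le (P := Fin (2 * n)) ![n / 2, n - n / 2, n]
    (x := ![1 / 4, 1 / 4, 1 / 2]) (by intro a; fin_cases a <;> norm_num)
  rw [Fin.sum_univ_three, Fin.prod_univ_three] at h
  have e0 : (![n / 2, n - n / 2, n] : Fin 3 → ℕ) 0 = n / 2 := rfl
  have e1 : (![n / 2, n - n / 2, n] : Fin 3 → ℕ) 1 = n - n / 2 := rfl
  have e2 : (![n / 2, n - n / 2, n] : Fin 3 → ℕ) 2 = n := rfl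
  have f0 : (![1 / 4, 1 / 4, 1 / 2] : Fin 3 → ℝ) 0 = 1 / 4 := rfl
  have f1 : (![1 / 4, 1 / 4, 1 / 2] : Fin 3 → ℝ) 1 = 1 / 4 := rfl
  have f2 : (![1 / 4, 1 / 4, 1 / 2] : Fin 3 → ℝ) 2 = 1 / 2 := rfl
  have e3 : n / 2 + (n - n / 2) = n := by omega
  rw [e0, e1, e2, f0, f1, f2, ← pow_add, e3, ← mul_pow,
    show (1 / 4 + 1 / 4 + 1 / 2 : ℝ) = 1 by norm_num, one_pow,
    show (1 / 4 * (1 / 2) : ℝ) = 8⁻¹ by norm_num, inv_pow] at h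
  rwa [← div_eq_mul_inv, div_le_one (by positivity)] at h

/-- The proportion of `d`-regular graphs on `2 n` vertices without the Ramsey property. -/
noncomputable def failureRatio (d n : ℕ) : ℝ := by
  classical exact
    (((Finset.univ : Finset (SimpleGraph (Fin (2 * n)))).filter fun G => G.IsRegularOfDegree d ∧
        ¬ Arrows G (cyclesUpTo n) (SimpleGraph.pathGraph n)).card : ℝ) /
      (((Finset.univ : Finset (SimpleGraph (Fin (2 * n)))).filter
        fun G => G.IsRegularOfDegree d).card : ℝ)

/-- Here `b` and `r` stand for the numbers of failing and of all regular graphs, `s` and `u` for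
sparse and all three-letter words, `t` for partitions. -/
theorem le_mul_of_counting_bounds {n d k : ℕ} {b u t s r M Q ξ θ : ℝ} (hξ : 0 < ξ) (hθ : 0 < θ)
    (hM : 0 ≤ M) (hb : 0 ≤ b) (ht : 0 ≤ t) (hs : 0 ≤ s) (hr : 0 ≤ r)
    (h1 : b * u ≤ 2 * M ^ k * t * s * r) (h2 : 8 ^ (d * n) ≤ (M + 1) ^ (d + 2) * u)
    (h3 : s * (θ ^ n * ξ ^ (d * n)) ≤ Q ^ (d * n)) (h4 : t ≤ 8 ^ n) :
    b ≤ 2 * (M + 1) ^ (k + d + 2) * (8 * (Q / (8 * ξ)) ^ d / θ) ^ n * r := by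
  have hpow : (8 * (Q / (8 * ξ)) ^ d / θ) ^ n =
      8 ^ n * (Q ^ (d * n) / (θ ^ n * ξ ^ (d * n))) / 8 ^ (d * n) := by
    rw [div_pow, mul_pow, ← pow_mul, div_pow, mul_pow]
    field_simp
  have h3' : s ≤ Q ^ (d * n) / (θ ^ n * ξ ^ (d * n)) := by rwa [le_div_iff₀ (by positivity)]
  set q := Q ^ (d * n) / (θ ^ n * ξ ^ (d * n))
  have hMk : M ^ k ≤ (M + 1) ^ k := pow_le_pow_left₀ hM (by linarith) k
  rw [hpow, ← mul_div_assoc, div_mul_eq_mul_div, le_div_iff₀ (by positivity)]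
  calc b * 8 ^ (d * n) ≤ b * ((M + 1) ^ (d + 2) * u) := mul_le_mul_of_nonneg_left h2 hb
    _ = (M + 1) ^ (d + 2) * (b * u) := by ring
    _ ≤ (M + 1) ^ (d + 2) * (2 * M ^ k * t * s * r) :=
        mul_le_mul_of_nonneg_left h1 (by positivity)
    _ ≤ (M + 1) ^ (d + 2) * (2 * (M + 1) ^ k * 8 ^ n * q * r) := by gcongr
    _ = _ := by ring

theorem failureRatio_le {n d : ℕ} (hd : 0 < d) (hm : 4 * d + 3 < n) {ξ θ : ℝ} (hξ : 0 < ξ)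
    (hθ : 0 < θ) (hθ1 : θ ≤ 1) :
    failureRatio d n ≤ 2 * (2 * (d * n) + 1) ^ (4 * d ^ 2 + d + 2) *
      (8 * ((1 + 4 * ξ + (2 + 2 * θ) * ξ ^ 2) / (8 * ξ)) ^ d / θ) ^ n := by
  classical
  have hn : 0 < n := by omega
  have h1 := card_not_arrows_mul_le hn hd hm
  have h2 := eight_pow_le_mul_card_words n d hn
  have h3 := card_sparse_mul_le (ι := Fin (d * n)) (fun b => d * ![n / 2, n - n / 2, n] b) n
    hξ.le hθ.le hθ1
  have h4 := card_words_partition_le n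
  have e0 : (![n / 2, n - n / 2, n] : Fin 3 → ℕ) 0 = n / 2 := rfl
  have e1 : (![n / 2, n - n / 2, n] : Fin 3 → ℕ) 1 = n - n / 2 := rfl
  have e3 : d * (n / 2) + d * (n - n / 2) = d * n := by
    rw [← mul_add]; congr 1; omega
  simp only [e0, e1, e3, Fintype.card_fin] at h3
  obtain ⟨G, hG⟩ := exists_isRegularOfDegree hd hm
  unfold failureRatio
  rw [div_le_iff₀ (by
    rw [Nat.cast_pos, Finset.card_pos]
    exact ⟨G, Finset.mem_filter.mpr ⟨Finset.mem_univ _, hG⟩⟩)]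
  have h1' : (_ : ℝ) ≤ _ := Nat.cast_le.mpr h1
  have h2' : (_ : ℝ) ≤ _ := Nat.cast_le.mpr h2
  push_cast at h1' h2'
  exact le_mul_of_counting_bounds hξ hθ (by positivity) (Nat.cast_nonneg _) (Nat.cast_nonneg _)
    (Nat.cast_nonneg _) (Nat.cast_nonneg _) h1' h2' h3 h4

theorem tendsto_failureRatio : Tendsto (failureRatio 31) atTop (𝓝 0) := by
  -- For fixed `θ` the best `ξ` is $1/\sqrt{2+2\theta}$. The nearly optimal $\theta=0.17045$ makes
  -- $2+2\theta=1.53^2$, so $\xi=1/1.53$ is rational, $Q/(8\xi)=0.8825$ and $\rho\approx0.974$.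
  set ρ : ℝ := 8 * ((1 + 4 * (100 / 153) + (2 + 2 * (3409 / 20000)) * (100 / 153) ^ 2) /
    (8 * (100 / 153))) ^ 31 / (3409 / 20000) with hρ
  have hρ0 : 0 ≤ ρ := by rw [hρ]; positivity
  have hρ1 : ρ < 1 := by rw [hρ]; norm_num
  have hlim : ∀ k : ℕ, Tendsto (fun n : ℕ => 2 * 63 ^ k * ((n : ℝ) ^ k * ρ ^ n)) atTop (𝓝 0) := by
    intro k
    have := (tendsto_pow_const_mul_const_pow_of_abs_lt_one k
      (by rwa [abs_of_nonneg hρ0])).const_mul (2 * 63 ^ k : ℝ)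
    rwa [mul_zero] at this
  refine squeeze_zero' (Eventually.of_forall fun n => ?_) ?_ (hlim (4 * 31 ^ 2 + 31 + 2))
  · unfold failureRatio; positivity
  · filter_upwards [eventually_gt_atTop (4 * 31 + 3)] with n hn
    have h := failureRatio_le (d := 31) (by norm_num) hn (ξ := 100 / 153) (θ := 3409 / 20000)
      (by norm_num) (by norm_num) (by norm_num)
    rw [← hρ] at h
    refine h.trans ?_
    generalize 4 * 31 ^ 2 + 31 + 2 = k
    have hn1 : (1 : ℝ) ≤ n := by exact_mod_cast (by omega : 1 ≤ n)
    have hbase : (2 * (((31 : ℕ) : ℝ) * n) + 1) ≤ 63 * n := by push_cast; linarith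
    calc _ ≤ 2 * (63 * (n : ℝ)) ^ k * ρ ^ n := by gcongr
      _ = _ := by rw [mul_pow]; ring

instance {n : ℕ} : MeasurableSingletonClass (SimpleGraph (Fin n)) where
  measurableSet_singleton G := by
    have : {G} = SimpleGraph.edgeSet ⁻¹' {G.edgeSet} := by
      ext H; simp
    rw [this]
    exact SimpleGraph.measurable_edgeSet (MeasurableSet.singleton _)

theorem randomRegular_arrows {d n : ℕ} (hd : 0 < d) (hm : 4 * d + 3 < n) :
    randomRegular (2 * n) d {G | Arrows G (cyclesUpTo n) (SimpleGraph.pathGraph n)} =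
      ENNReal.ofReal (1 - failureRatio d n) := by
  classical
  obtain ⟨G₀, hG₀⟩ := exists_isRegularOfDegree hd hm
  set reg := (Finset.univ : Finset (SimpleGraph (Fin (2 * n)))).filter
    fun G => G.IsRegularOfDegree d with hreg
  set good := (Finset.univ : Finset (SimpleGraph (Fin (2 * n)))).filter
    fun G => Arrows G (cyclesUpTo n) (SimpleGraph.pathGraph n) with hgood
  have hpos : 0 < reg.card := Finset.card_pos.mpr
    ⟨G₀, Finset.mem_filter.mpr ⟨Finset.mem_univ _, hG₀⟩⟩
  have h1 : randomRegular (2 * n) d {G | Arrows G (cyclesUpTo n) (SimpleGraph.pathGraph n)} =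
      uniformOn (reg : Set (SimpleGraph (Fin (2 * n)))) (good : Set _) := by
    have e1 : (good : Set (SimpleGraph (Fin (2 * n)))) =
        {G | Arrows G (cyclesUpTo n) (SimpleGraph.pathGraph n)} := by
      ext G; simp [hgood]
    have e2 : (reg : Set (SimpleGraph (Fin (2 * n)))) = {G | G.IsRegularOfDegree d} := by
      ext G; simp [hreg]
    rw [e1, e2, randomRegular]
  have h2 : failureRatio d n = ((reg \ good).card : ℝ) / reg.card := by
    unfold failureRatio
    congr 3
    ext G
    simp [hreg, hgood]
  have h3 : 1 - failureRatio d n = ((reg ∩ good).card : ℝ) / reg.card := by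
    rw [h2, eq_div_iff (by positivity), sub_mul, div_mul_cancel₀ _ (by positivity), one_mul,
      sub_eq_iff_eq_add]
    exact_mod_cast (Finset.card_inter_add_card_sdiff reg good).symm
  rw [h1, h3, uniformOn_apply_finset, ENNReal.ofReal_div_of_pos (by positivity),
    ENNReal.ofReal_natCast, ENNReal.ofReal_natCast]

end Asymptotics

end SizeRamsey

theorem theorem3p4 :
    Tendsto
      (fun n : ℕ => SizeRamsey.randomRegular (2 * n) 31
        {G | SizeRamsey.Arrows G (SizeRamsey.cyclesUpTo n) (SimpleGraph.pathGraph n)})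
      atTop (𝓝 1) ∧
    ∀ᶠ n : ℕ in atTop,
      SizeRamsey.sizeRamsey (SizeRamsey.cyclesUpTo n) (SimpleGraph.pathGraph n) ≤
        ((31 * n : ℕ) : ℕ∞) := by
  classical
  constructor
  · have h1 : Tendsto (fun n => ENNReal.ofReal (1 - SizeRamsey.failureRatio 31 n)) atTop
        (𝓝 (ENNReal.ofReal (1 - 0))) :=
      ENNReal.tendsto_ofReal (tendsto_const_nhds.sub SizeRamsey.tendsto_failureRatio)
    rw [sub_zero, ENNReal.ofReal_one] at h1
    refine h1.congr' ?_
    filter_upwards [eventually_gt_atTop (4 * 31 + 3)] with n hn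
    exact (SizeRamsey.randomRegular_arrows (by norm_num) hn).symm
  · filter_upwards [eventually_gt_atTop (4 * 31 + 3),
      SizeRamsey.tendsto_failureRatio.eventually_lt_const one_pos] with n hn hlt
    -- Were there no regular graph, the ratio would be $0/0=0$ by convention and `hlt` would say
    -- nothing.
    obtain ⟨G₀, hG₀⟩ := SizeRamsey.exists_isRegularOfDegree (n := n) (d := 31) (by norm_num) hn
    have hex : ∃ G : SimpleGraph (Fin (2 * n)), G.IsRegularOfDegree 31 ∧
        SizeRamsey.Arrows G (SizeRamsey.cyclesUpTo n) (SimpleGraph.pathGraph n) := by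
      by_contra! hno
      refine hlt.ne ?_
      unfold SizeRamsey.failureRatio
      rw [Finset.filter_congr (q := fun G => G.IsRegularOfDegree 31)
        fun G _ => ⟨fun h => h.1, fun h => ⟨h, hno G h⟩⟩]
      refine div_self (Nat.cast_ne_zero.mpr (Finset.card_pos.mpr ?_).ne')
      exact ⟨G₀, Finset.mem_filter.mpr ⟨Finset.mem_univ _, hG₀⟩⟩
    obtain ⟨G, hG, harr⟩ := hex
    refine sInf_le ⟨2 * n, G, harr, ?_⟩
    have hcard := SizeRamsey.card_edgeFinset_of_isRegularOfDegree hG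
    rw [Fintype.card_fin] at hcard
    rw [← SimpleGraph.coe_edgeFinset, Set.encard_coe_eq_coe_finsetCard]
    congr 1
    omega
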